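/- Consider the problem of minimizing $f(x)$ subject to $c(x)=0$, where $f:\mathbb{R}^n\to\mathbb{R}$ and $c:\mathbb{R}^n\to\mathbb{R}^m$ are three times continuously differentiable. Let $g=\nabla f$, $A(x)=[\nabla c_1(x)\ \cdots\ \nabla c_m(x)]$, and call $x$ a first-order KKT (stationary) point if $c(x)=0$ and $g(x)=A(x)y$ for some $y\in\mathbb{R}^m$. Assume that at every stationary point the vectors $\nabla c_1(x),\dots,\nabla c_m(x)$ are linearly independent. For $\sigma\ge 0$ and $\delta\ge 0$ put \[ \phi_\sigma(x;\delta)=f(x)-c(x)^T y_\sigma(x;\delta),\qquad y_\sigma(x;\delta)=\arg\min_y\ \tfrac12\|A(x)y-g(x)\|_2^2+\sigma\,c(x)^Ty+\tfrac12\delta^2\|y\|_2^2, \] and $\phi_\sigma(x)=\phi_\sigma(x;0)$. Fix $\sigma\ge0$ and let $x^*$ be a second-order KKT point, that is, a first-order KKT point with $p^T\nabla^2\phi_{s}(x^*)p\ge 0$ for all $s\ge0$ and all $p$ with $A(x^*)^Tp=0$. Assume $\nabla^2\phi_\sigma(x^*)\succ0$. For $\delta>0$ let $x(\delta)$ denote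 a local minimizer of $\phi_\sigma(\cdot;\delta)$ of least distance to $x^*$ (if one exists). Let $G$ be a rule that assigns to a function $\varphi:\mathbb{R}^n\to\mathbb{R}$ and a point $x$ an update direction $G(\varphi,x)\in\mathbb{R}^n$. Suppose there are $\bar\delta>0$, an open set $B$ containing $x^*$, and numbers $M_\delta\le M$ ($M$ independent of $\delta$) such that for every $\widetilde x_0\in B$ and $0<\delta\le\bar\delta$ the sequence $\widetilde x_{k+1}=\widetilde x_k+G(\phi_\sigma(\cdot;\delta),\widetilde x_k)$ converges to $x(\delta)$ and satisfies \[ \|x(\delta)-\widetilde x_{k+1}\|\le M_\delta\,\|x(\delta)-\widetilde x_k\|^2\qquad\text{for all }k\ge0 . \] Then there exist an open set $B'$ containing $x^*$ and $0<\delta'<1$ such that for every $x_1\in B'$ and $0<\delta_0\le\delta'$ the sequence $(x_k)$ defined for $k=1,2,\dots$ by \[ \delta_k=\max\bigl\{\min\{\|\nabla\phi_\sigma(x_k;\delta_{k-1})\|,\ \delta_{k-1}\},\ \delta_{k-1}^2\bigr\},\qquad x_{k+1}=x_k+G(\phi_\sigma(\cdot;\delta_k),x_k) \] converges to $x^*$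 R-quadratically: $x_k\to x^*$, and there are a real sequence $\alpha_k\to0$ and a constant $K>0$ such that $\|x_k-x^*\|\le\alpha_k$ and $|\alpha_{k+1}|\le K|\alpha_k|^2$ for all sufficiently large $k$. -/

import Mathlib

open Filter Topology

noncomputable section

namespace FletcherPenalty

/-- `ℝⁿ` with the Euclidean norm. -/
abbrev Vec (n : ℕ) : Type := EuclideanSpace ℝ (Fin n)

variable {n m : ℕ}

/-- The gradient `g_i(x) = ∇c_i(x)` of the `i`-th constraint, i.e. the `i`-th column of `A(x)`. -/
def consGrad (c : Vec n → Vec m) (i : Fin m) (x : Vec n) : Vec n :=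
  gradient (fun z => c z i) x

/-- The product `A(x) y = ∑ i, y_i ∇c_i(x)`, where `A(x) = ∇c(x)` is `n`-by-`m`. -/
def consJac (c : Vec n → Vec m) (x : Vec n) (y : Vec m) : Vec n :=
  ∑ i, y i • consGrad c i x

/-- LICQ at `x`: the constraint gradients at `x` are linearly independent. -/
def LICQAt (c : Vec n → Vec m) (x : Vec n) : Prop :=
  LinearIndependent ℝ (fun i => consGrad c i x)

/-- First-order KKT (stationary) points of `min f(x)` subject to `c(x) = 0`:
feasibility, and `∇f(x) - A(x) y = 0` for some multiplier vector `y`. -/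
def IsFirstOrderKKT (f : Vec n → ℝ) (c : Vec n → Vec m) (x : Vec n) : Prop :=
  c x = 0 ∧ ∃ y : Vec m, gradient f x = consJac c x y

/-- The objective `½‖A(x)y - g(x)‖² + σ c(x)ᵀy + ½δ²‖y‖²` of the (regularized) shifted
least-squares problem for the multiplier estimate. -/
def multiplierObjective (f : Vec n → ℝ) (c : Vec n → Vec m) (σ δ : ℝ) (x : Vec n)
    (y : Vec m) : ℝ :=
  (1 / 2 : ℝ) * ‖consJac c x y - gradient f x‖ ^ 2 + σ * inner ℝ (c x) y
    + (1 / 2 : ℝ) * δ ^ 2 * ‖y‖ ^ 2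

/-- The multiplier estimate `y_σ(x;δ)`: the minimizer over `y` of `multiplierObjective`. It exists
and is unique if `δ ≠ 0`, and also if `δ = 0` and LICQ holds at `x`. (Where there is no minimizer,
the value is unspecified.) -/
def multiplier (f : Vec n → ℝ) (c : Vec n → Vec m) (σ δ : ℝ) (x : Vec n) : Vec m :=
  Classical.epsilon fun y : Vec m => IsMinOn (multiplierObjective f c σ δ x) Set.univ y

/-- The penalty function `φ_σ(x;δ) = f(x) - c(x)ᵀ y_σ(x;δ)`. The unregularized penalty function
`φ_σ(x)` is the case `δ = 0`. -/
def penalty (f : Vec n → ℝ) (c : Vec n → Vec m) (σ δ : ℝ) (x : Vec n) : ℝ :=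
  f x - inner ℝ (c x) (multiplier f c σ δ x)

/-- The Hessian `∇²φ(x)`, as a linear operator. -/
def hess (φ : Vec n → ℝ) (x : Vec n) : Vec n →L[ℝ] Vec n :=
  fderiv ℝ (gradient φ) x

/-- Second-order KKT points: first-order KKT points such that for every `σ ≥ 0` the Hessian of the
unregularized penalty function has nonnegative curvature on the kernel of `A(x)ᵀ`. -/
def IsSecondOrderKKT (f : Vec n → ℝ) (c : Vec n → Vec m) (x : Vec n) : Prop :=
  IsFirstOrderKKT f c x ∧
    ∀ σ : ℝ, 0 ≤ σ → ∀ p : Vec n, (∀ i, inner ℝ (consGrad c i x) p = 0) →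
      0 ≤ inner ℝ p (hess (penalty f c σ 0) x p)

/-- The set of those local minimizers of `φ` that are nearest to `a` among all local minimizers
of `φ`. -/
def nearestLocalMins (φ : Vec n → ℝ) (a : Vec n) : Set (Vec n) :=
  {z | IsLocalMin φ z ∧ ∀ w, IsLocalMin φ w → ‖z - a‖ ≤ ‖w - a‖}

/-- The minimization method with update direction `G(φ, x)`, applied to a fixed function `φ`:
`z_0 = z₀`, `z_{k+1} = z_k + G(φ, z_k)`. -/
def innerIter (G : (Vec n → ℝ) → Vec n → Vec n) (φ : Vec n → ℝ) (z₀ : Vec n) : ℕ → Vec n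
  | 0 => z₀
  | k + 1 => innerIter G φ z₀ k + G φ (innerIter G φ z₀ k)

/-- The algorithm with adaptive regularization, for a family `φ δ` of functions, with update rule
`ν`, initial point `x₁` and initial parameter `δ₀`. The state with index `k` is the pair
`(x_{k+1}, δ_k)`. One pass of the loop computes
`δ_k = max {min {‖∇φ(x_k; δ_{k-1})‖, δ_{k-1}}, ν(δ_{k-1})}` and
`x_{k+1} = x_k + G(φ(·; δ_k), x_k)`. -/
def algState (G : (Vec n → ℝ) → Vec n → Vec n) (φ : ℝ → Vec n → ℝ) (ν : ℝ → ℝ)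
    (x₁ : Vec n) (δ₀ : ℝ) : ℕ → Vec n × ℝ
  | 0 => (x₁, δ₀)
  | k + 1 =>
    let x := (algState G φ ν x₁ δ₀ k).1
    let δ := (algState G φ ν x₁ δ₀ k).2
    let δnew := max (min ‖gradient (φ δ) x‖ δ) (ν δ)
    (x + G (φ δnew) x, δnew)

/-- `x_k → a` with order at least `τ`. -/
def ConvergesWithOrder {E : Type*} [NormedAddCommGroup E] (x : ℕ → E) (a : E) (τ : ℝ) : Prop :=
  Tendsto x atTop (𝓝 a) ∧
    ∃ M : ℝ, 0 < M ∧ ∀ᶠ k in atTop, ‖x (k + 1) - a‖ ≤ M * ‖x k - a‖ ^ τ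

/-- `x_k → a` with R-order at least `τ`; R-quadratic convergence is the case `τ = 2`. -/
def ConvergesWithROrder {E : Type*} [NormedAddCommGroup E] (x : ℕ → E) (a : E) (τ : ℝ) : Prop :=
  ∃ α : ℕ → ℝ, (∀ᶠ k in atTop, ‖x k - a‖ ≤ α k) ∧ ConvergesWithOrder α 0 τ

end FletcherPenalty

end

/-!
Where `A(x)ᵀA(x) + δ²` is invertible, the multiplier estimate solves the normal equations
`(A(x)ᵀA(x) + δ²) y = A(x)ᵀg(x) - σ c(x)` (`multiplier_eq_normalSol`). LICQ makes this operator
invertible at `(x*, 0)`, hence for all `(x, δ²)` nearby, so that `φ_σ(x;δ) = Ψ(x, δ²)` for a function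
`Ψ` that is `C²` near `(x*, 0)` (`contDiffAt_smoothPenalty`). Its partial gradient `P = ∇ₓΨ` vanishes
at `(x*, 0)` (`partialGrad_eq_zero`), is strictly differentiable there, and has the positive definite
partial derivative `∇²φ_σ(x*)` in `x`.

Strict differentiability gives, uniformly in small `t`, strong monotonicity and a Lipschitz bound of
`P(·, t)` on a ball around `x*`, and `‖P(x*, t)‖ = O(t)`. With `t = δ²` it follows that `φ_σ(·;δ)` has
exactly one local minimizer in the ball; it is therefore `x(δ)`, it satisfies `‖x(δ) - x*‖ = O(δ²)`,
and `‖∇φ_σ(x;δ)‖ = O(‖x - x(δ)‖)` in the ball (`exists_nearestLocalMins_bounds`).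

For an iterate `x` reached with the parameter `δ`, put `β = ‖x - x(δ)‖ + δ²`. The next parameter is
`O(‖x - x(δ)‖) + δ²`, so its square is `O(β²)`. The next iterate is a quadratically convergent step
towards a minimizer at distance `O(β)` from `x`. So `β` decreases quadratically
(`adaptive_step_bound`), and since `‖x - x*‖ = O(β)` the convergence is R-quadratic
(`algState_convergesWithROrder`).
-/

namespace FletcherPenalty

noncomputable section

variable {n m : ℕ}

/-! ### The multiplier estimate in closed form -/

theorem consJac_eq_adjoint {c : Vec n → Vec m} {x : Vec n} (hc : DifferentiableAt ℝ c x)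
    (y : Vec m) : consJac c x y = (fderiv ℝ c x).adjoint y := by
  refine ext_inner_right ℝ fun v => ?_
  rw [ContinuousLinearMap.adjoint_inner_left, consJac, sum_inner, PiLp.inner_apply]
  refine Finset.sum_congr rfl fun i _ => ?_
  have h : HasFDerivAt (fun z => c z i) ((EuclideanSpace.proj i).comp (fderiv ℝ c x)) x :=
    (EuclideanSpace.proj (𝕜 := ℝ) i).hasFDerivAt.comp x hc.hasFDerivAt
  rw [inner_smul_left, consGrad, inner_gradient_left, h.fderiv]
  simp [mul_comm]

/-- The operator `A(x)ᵀA(x) + t` of the normal equations of the regularized shifted least-squares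
problem, with `t` in place of `δ²`. -/
def normalOp (c : Vec n → Vec m) (p : Vec n × ℝ) : Vec m →L[ℝ] Vec m :=
  (fderiv ℝ c p.1) ∘L (fderiv ℝ c p.1).adjoint + p.2 • ContinuousLinearMap.id ℝ (Vec m)

/-- The solution `(A(x)ᵀA(x) + t)⁻¹ (A(x)ᵀg(x) - σ c(x))` of the normal equations. If the operator
is singular, `Ring.inverse` is zero. -/
def normalSol (f : Vec n → ℝ) (c : Vec n → Vec m) (σ : ℝ) (p : Vec n × ℝ) : Vec m :=
  Ring.inverse (normalOp c p) (fderiv ℝ c p.1 (gradient f p.1) - σ • c p.1)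

theorem normalOp_normalSol {c : Vec n → Vec m} {p : Vec n × ℝ} (hu : IsUnit (normalOp c p))
    (f : Vec n → ℝ) (σ : ℝ) :
    normalOp c p (normalSol f c σ p) = fderiv ℝ c p.1 (gradient f p.1) - σ • c p.1 := by
  rw [normalSol, ← mul_apply_eq_comp, Ring.mul_inverse_cancel _ hu, one_apply_eq_self]

/-- Completing the square at the solution of the normal equations. -/
theorem multiplierObjective_eq {c : Vec n → Vec m} {x : Vec n} {δ : ℝ}
    (hc : DifferentiableAt ℝ c x) (hu : IsUnit (normalOp c (x, δ ^ 2)))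
    (f : Vec n → ℝ) (σ : ℝ) (d : Vec m) :
    multiplierObjective f c σ δ x (normalSol f c σ (x, δ ^ 2) + d) =
      multiplierObjective f c σ δ x (normalSol f c σ (x, δ ^ 2)) +
        (1 / 2 * ‖(fderiv ℝ c x).adjoint d‖ ^ 2 + 1 / 2 * δ ^ 2 * ‖d‖ ^ 2) := by
  have h := normalOp_normalSol hu f σ
  set y := normalSol f c σ (x, δ ^ 2)
  have h' : inner ℝ ((fderiv ℝ c x).adjoint y - gradient f x) ((fderiv ℝ c x).adjoint d)
      + σ * inner ℝ (c x) d + δ ^ 2 * inner ℝ y d = 0 := by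
    have := congrArg (fun z => inner ℝ z d) h
    simp only [normalOp, add_apply, ContinuousLinearMap.comp_apply,
      smul_apply, ContinuousLinearMap.id_apply, inner_add_left,
      inner_sub_left, real_inner_smul_left] at this
    rw [inner_sub_left, ContinuousLinearMap.adjoint_inner_right,
      ContinuousLinearMap.adjoint_inner_right]
    linarith
  simp only [multiplierObjective, consJac_eq_adjoint hc, map_add, inner_add_right]
  rw [add_sub_right_comm, norm_add_sq_real, norm_add_sq_real]
  linear_combination h'

theorem eq_zero_of_sq_terms_eq_zero {c : Vec n → Vec m} {x : Vec n} {δ : ℝ}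
    (hu : IsUnit (normalOp c (x, δ ^ 2))) {d : Vec m}
    (hd : 1 / 2 * ‖(fderiv ℝ c x).adjoint d‖ ^ 2 + 1 / 2 * δ ^ 2 * ‖d‖ ^ 2 ≤ 0) : d = 0 := by
  have h1 : ‖(fderiv ℝ c x).adjoint d‖ ^ 2 = 0 := by
    nlinarith [sq_nonneg ‖(fderiv ℝ c x).adjoint d‖, sq_nonneg (δ * ‖d‖)]
  have h2 : (δ * ‖d‖) ^ 2 = 0 := by
    nlinarith [sq_nonneg ‖(fderiv ℝ c x).adjoint d‖, sq_nonneg (δ * ‖d‖)]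
  have hA : (fderiv ℝ c x).adjoint d = 0 := by simpa using h1
  have hδ : δ ^ 2 • d = 0 := by simpa using h2
  have hT : normalOp c (x, δ ^ 2) d = 0 := by
    simp only [normalOp, add_apply, ContinuousLinearMap.comp_apply,
      smul_apply, ContinuousLinearMap.id_apply, hA, hδ, map_zero, add_zero]
  have := congrArg (⇑(Ring.inverse (normalOp c (x, δ ^ 2)))) hT
  rwa [← mul_apply_eq_comp, Ring.inverse_mul_cancel _ hu,
    one_apply_eq_self, map_zero] at this

theorem multiplier_eq_normalSol {c : Vec n → Vec m} {x : Vec n} {δ : ℝ}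
    (hc : DifferentiableAt ℝ c x) (hu : IsUnit (normalOp c (x, δ ^ 2)))
    (f : Vec n → ℝ) (σ : ℝ) :
    multiplier f c σ δ x = normalSol f c σ (x, δ ^ 2) := by
  set y := normalSol f c σ (x, δ ^ 2) with hy
  have hex : ∃ y : Vec m, IsMinOn (multiplierObjective f c σ δ x) Set.univ y := by
    refine ⟨y, fun z _ => ?_⟩
    have := multiplierObjective_eq hc hu f σ (z - y)
    rw [← hy, add_sub_cancel] at this
    simp only [Set.mem_ofPred_eq]
    rw [this]
    exact le_add_of_nonneg_right (by positivity)
  have hmin := Classical.epsilon_spec hex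
  change IsMinOn _ _ (multiplier f c σ δ x) at hmin
  have h1 := hmin (Set.mem_univ y)
  have h2 := multiplierObjective_eq hc hu f σ (multiplier f c σ δ x - y)
  rw [← hy, add_sub_cancel] at h2
  simp only [Set.mem_ofPred_eq] at h1
  exact sub_eq_zero.1 (eq_zero_of_sq_terms_eq_zero hu (by linarith))

/-! ### The penalty function as a smooth function of the point and of the squared parameter -/

/-- The penalty function as a function of `(x, t)`, where `t` stands for `δ²`. -/
def smoothPenalty (f : Vec n → ℝ) (c : Vec n → Vec m) (σ : ℝ) (p : Vec n × ℝ) : ℝ :=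
  f p.1 - inner ℝ (c p.1) (normalSol f c σ p)

/-- The partial gradient of `smoothPenalty` with respect to `x`. -/
def partialGrad (f : Vec n → ℝ) (c : Vec n → Vec m) (σ : ℝ) (p : Vec n × ℝ) : Vec n :=
  (InnerProductSpace.toDual ℝ (Vec n)).symm
    (fderiv ℝ (smoothPenalty f c σ) p ∘L ContinuousLinearMap.inl ℝ (Vec n) ℝ)

/-- Conjugation on `ℝ` is definitionally the identity, so the conjugate-linear inverse of the Riesz
isomorphism is a continuous linear map. -/
theorem contDiff_toDual_symm {k : WithTop ℕ∞} :
    ContDiff ℝ k (InnerProductSpace.toDual ℝ (Vec n)).symm :=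
  (show StrongDual ℝ (Vec n) →L[ℝ] Vec n from
    ((InnerProductSpace.toDual ℝ (Vec n)).symm : StrongDual ℝ (Vec n) →L⋆[ℝ] Vec n)).contDiff

/-- As for `contDiff_toDual_symm`, conjugate-linear maps over `ℝ` are linear by definition. -/
theorem contDiff_adjoint {k : WithTop ℕ∞} :
    ContDiff ℝ k (fun T : Vec n →L[ℝ] Vec m => T.adjoint) :=
  (show (Vec n →L[ℝ] Vec m) →L[ℝ] (Vec m →L[ℝ] Vec n) from
    ((ContinuousLinearMap.adjoint : (Vec n →L[ℝ] Vec m) ≃ₗᵢ⋆[ℝ] _) :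
      (Vec n →L[ℝ] Vec m) →L⋆[ℝ] (Vec m →L[ℝ] Vec n))).contDiff

theorem contDiff_normalOp {c : Vec n → Vec m} (hc : ContDiff ℝ 3 c) :
    ContDiff ℝ 2 (normalOp c) := by
  have h : ContDiff ℝ 2 (fun p : Vec n × ℝ => fderiv ℝ c p.1) :=
    (hc.fderiv_right (m := 2) (by norm_num)).comp contDiff_fst
  exact (h.clm_comp (contDiff_adjoint.comp h)).add (contDiff_snd.smul contDiff_const)

theorem contDiffAt_normalSol {f : Vec n → ℝ} {c : Vec n → Vec m} (hf : ContDiff ℝ 3 f)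
    (hc : ContDiff ℝ 3 c) (σ : ℝ) {p : Vec n × ℝ} (hu : IsUnit (normalOp c p)) :
    ContDiffAt ℝ 2 (normalSol f c σ) p := by
  have hc' : ContDiff ℝ 2 (fun p : Vec n × ℝ => c p.1) :=
    (hc.of_le (by norm_num)).comp contDiff_fst
  have hD : ContDiff ℝ 2 (fun p : Vec n × ℝ => fderiv ℝ c p.1) :=
    (hc.fderiv_right (m := 2) (by norm_num)).comp contDiff_fst
  have hg : ContDiff ℝ 2 (fun p : Vec n × ℝ => gradient f p.1) :=
    contDiff_toDual_symm.comp ((hf.fderiv_right (m := 2) (by norm_num)).comp contDiff_fst)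
  have hinv : ContDiffAt ℝ 2 (Ring.inverse ∘ normalOp c) p := by
    have h := contDiffAt_ringInverse ℝ (n := 2) hu.unit
    rw [hu.unit_spec] at h
    exact ContDiffAt.comp p h (contDiff_normalOp hc).contDiffAt
  have hb : ContDiff ℝ 2 (fun p : Vec n × ℝ => fderiv ℝ c p.1 (gradient f p.1) - σ • c p.1) :=
    (hD.clm_apply hg).sub (hc'.const_smul σ)
  exact hinv.clm_apply hb.contDiffAt

theorem contDiffAt_smoothPenalty {f : Vec n → ℝ} {c : Vec n → Vec m} (hf : ContDiff ℝ 3 f)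
    (hc : ContDiff ℝ 3 c) (σ : ℝ) {p : Vec n × ℝ} (hu : IsUnit (normalOp c p)) :
    ContDiffAt ℝ 2 (smoothPenalty f c σ) p := by
  have hf' : ContDiff ℝ 2 (fun p : Vec n × ℝ => f p.1) :=
    (hf.of_le (by norm_num)).comp contDiff_fst
  have hc' : ContDiff ℝ 2 (fun p : Vec n × ℝ => c p.1) :=
    (hc.of_le (by norm_num)).comp contDiff_fst
  exact hf'.contDiffAt.sub (hc'.contDiffAt.inner ℝ (contDiffAt_normalSol hf hc σ hu))

theorem isOpen_isUnit_normalOp {c : Vec n → Vec m} (hc : ContDiff ℝ 3 c) :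
    IsOpen {p | IsUnit (normalOp c p)} :=
  Units.isOpen.preimage (contDiff_normalOp hc).continuous

theorem penalty_eq_smoothPenalty {f : Vec n → ℝ} {c : Vec n → Vec m} (hc : ContDiff ℝ 3 c)
    (σ : ℝ) {δ : ℝ} {x : Vec n} (hu : IsUnit (normalOp c (x, δ ^ 2))) :
    penalty f c σ δ x = smoothPenalty f c σ (x, δ ^ 2) := by
  rw [penalty, smoothPenalty,
    multiplier_eq_normalSol (hc.differentiable (by norm_num) x) hu f σ]

theorem hasGradientAt_penalty {f : Vec n → ℝ} {c : Vec n → Vec m} (hf : ContDiff ℝ 3 f)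
    (hc : ContDiff ℝ 3 c) (σ : ℝ) {δ : ℝ} {x : Vec n} (hu : IsUnit (normalOp c (x, δ ^ 2))) :
    HasGradientAt (penalty f c σ δ) (partialGrad f c σ (x, δ ^ 2)) x := by
  have hev : penalty f c σ δ =ᶠ[𝓝 x] fun z => smoothPenalty f c σ (z, δ ^ 2) := by
    have : ∀ᶠ z in 𝓝 x, IsUnit (normalOp c (z, δ ^ 2)) :=
      (Continuous.prodMk_left (δ ^ 2)).continuousAt.eventually
        ((isOpen_isUnit_normalOp hc).mem_nhds hu)
    filter_upwards [this] with z hz using penalty_eq_smoothPenalty hc σ hz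
  have hd : HasFDerivAt (smoothPenalty f c σ) (fderiv ℝ (smoothPenalty f c σ) (x, δ ^ 2))
      (x, δ ^ 2) :=
    ((contDiffAt_smoothPenalty hf hc σ hu).differentiableAt (by norm_num)).hasFDerivAt
  have := HasFDerivAt.comp (f := fun z : Vec n => (z, δ ^ 2)) x hd
    (hasFDerivAt_prodMk_left x (δ ^ 2))
  exact HasGradientAt.congr_of_eventuallyEq (hasFDerivAt_iff_hasGradientAt.1 this) hev

theorem contDiffAt_partialGrad {f : Vec n → ℝ} {c : Vec n → Vec m} (hf : ContDiff ℝ 3 f)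
    (hc : ContDiff ℝ 3 c) (σ : ℝ) {p : Vec n × ℝ} (hu : IsUnit (normalOp c p)) :
    ContDiffAt ℝ 1 (partialGrad f c σ) p :=
  contDiff_toDual_symm.contDiffAt.comp p
    (((contDiffAt_smoothPenalty hf hc σ hu).fderiv_right (m := 1) (by norm_num)).clm_comp
      contDiffAt_const)

/-- LICQ makes `A(x)ᵀA(x)` invertible. -/
theorem LICQAt.isUnit_normalOp {c : Vec n → Vec m} {x : Vec n} (h : LICQAt c x)
    (hc : DifferentiableAt ℝ c x) : IsUnit (normalOp c (x, 0)) := by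
  rw [ContinuousLinearMap.isUnit_iff_isUnit_toLinearMap, LinearMap.isUnit_iff_ker_eq_bot,
    LinearMap.ker_eq_bot']
  intro y hy
  have hy' : fderiv ℝ c x ((fderiv ℝ c x).adjoint y) = 0 := by simpa [normalOp] using hy
  have h0 : consJac c x y = 0 := by
    rw [consJac_eq_adjoint hc, ← inner_self_eq_zero (𝕜 := ℝ),
      ContinuousLinearMap.adjoint_inner_left, hy', inner_zero_right]
  ext i
  exact Fintype.linearIndependent_iff.1 h (fun i => y i) h0 i

/-- At a stationary point the penalty gradient is `g - A y`, with `y` the multiplier estimate, and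
the unregularized estimate is the Lagrange multiplier. -/
theorem partialGrad_eq_zero {f : Vec n → ℝ} {c : Vec n → Vec m} (hf : ContDiff ℝ 3 f)
    (hc : ContDiff ℝ 3 c) (σ : ℝ) {x : Vec n} (hx : IsFirstOrderKKT f c x)
    (hu : IsUnit (normalOp c (x, 0))) : partialGrad f c σ (x, 0) = 0 := by
  obtain ⟨hcx, y, hy⟩ := hx
  have hcd := hc.differentiable (by norm_num) x
  rw [consJac_eq_adjoint hcd] at hy
  have hsol : normalSol f c σ (x, 0) = y := by
    have : normalOp c (x, 0) y = fderiv ℝ c x (gradient f x) - σ • c x := by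
      simp [normalOp, hy, hcx]
    rw [normalSol, ← this, ← mul_apply_eq_comp, Ring.inverse_mul_cancel _ hu,
      one_apply_eq_self]
  have hfd : DifferentiableAt ℝ f x := hf.differentiable (by norm_num) x
  have hF : HasFDerivAt (fun p : Vec n × ℝ => f p.1)
      (fderiv ℝ f x ∘L ContinuousLinearMap.fst ℝ (Vec n) ℝ) (x, 0) :=
    HasFDerivAt.comp (x, (0 : ℝ)) hfd.hasFDerivAt hasFDerivAt_fst
  have hC : HasFDerivAt (fun p : Vec n × ℝ => c p.1)
      (fderiv ℝ c x ∘L ContinuousLinearMap.fst ℝ (Vec n) ℝ) (x, 0) :=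
    HasFDerivAt.comp (x, (0 : ℝ)) hcd.hasFDerivAt hasFDerivAt_fst
  have hS := ((contDiffAt_normalSol hf hc σ hu).differentiableAt (by norm_num)).hasFDerivAt
  have hP : fderiv ℝ (smoothPenalty f c σ) (x, 0) = _ := (hF.sub (hC.inner ℝ hS)).fderiv
  rw [partialGrad, hP, LinearIsometryEquiv.map_eq_zero_iff]
  ext v
  have hv : inner ℝ (gradient f x) v = fderiv ℝ f x v := inner_gradient_left
  rw [hy, ContinuousLinearMap.adjoint_inner_left] at hv
  -- the derivative of the multiplier estimate is multiplied by `c x = 0`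
  simp [hsol, hcx, ← hv, real_inner_comm]

/-! ### Local minimizers of a perturbed function near a nondegenerate minimizer -/

/-- A linear map with positive quadratic form in finite dimension is coercive. -/
theorem exists_pos_mul_sq_le_inner {E : Type*} [NormedAddCommGroup E] [InnerProductSpace ℝ E]
    [FiniteDimensional ℝ E] (H : E →L[ℝ] E) (hH : ∀ p, p ≠ 0 → 0 < inner ℝ p (H p)) :
    ∃ μ : ℝ, 0 < μ ∧ ∀ p, μ * ‖p‖ ^ 2 ≤ inner ℝ p (H p) := by
  rcases subsingleton_or_nontrivial E with hE | hE
  · exact ⟨1, one_pos, fun p => by simp [Subsingleton.elim p 0]⟩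
  have : ProperSpace E := FiniteDimensional.proper ℝ E
  obtain ⟨q, hq, hmin⟩ := (isCompact_sphere (0 : E) 1).exists_isMinOn
    (NormedSpace.sphere_nonempty.2 zero_le_one)
    (f := fun p => inner ℝ p (H p)) (by fun_prop)
  have hq1 : ‖q‖ = 1 := by simpa using hq
  refine ⟨inner ℝ q (H q), hH q (by rintro rfl; simp at hq1), fun p => ?_⟩
  rcases eq_or_ne p 0 with rfl | hp
  · simp
  have hp' : ‖p‖ ≠ 0 := norm_ne_zero_iff.2 hp
  have h := hmin (show ‖p‖⁻¹ • p ∈ Metric.sphere (0 : E) 1 by simp [norm_smul, hp'])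
  simp only [Set.mem_ofPred_eq, map_smul, real_inner_smul_left, real_inner_smul_right] at h
  calc inner ℝ q (H q) * ‖p‖ ^ 2 ≤ ‖p‖⁻¹ * (‖p‖⁻¹ * inner ℝ p (H p)) * ‖p‖ ^ 2 := by gcongr
    _ = inner ℝ p (H p) := by field_simp

/-- If the gradient of `φ` points outwards on the sphere around `a`, then `φ` has a local minimizer
inside. -/
theorem exists_isLocalMin_of_inner_pos {E : Type*} [NormedAddCommGroup E]
    [InnerProductSpace ℝ E] [FiniteDimensional ℝ E] {φ : E → ℝ} {P : E → E} {a : E} {r : ℝ}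
    (hr : 0 < r) (hφ : ∀ x ∈ Metric.closedBall a r, HasGradientAt φ (P x) x)
    (hP : ∀ x, ‖x - a‖ = r → 0 < inner ℝ (P x) (x - a)) :
    ∃ z ∈ Metric.ball a r, IsLocalMin φ z := by
  have : ProperSpace E := FiniteDimensional.proper ℝ E
  obtain ⟨z, hz, hmin⟩ := (isCompact_closedBall a r).exists_isMinOn
    (Metric.nonempty_closedBall.2 hr.le) (f := φ)
    (fun x hx => (hφ x hx).hasFDerivAt.continuousAt.continuousWithinAt)
  have hza : ‖z - a‖ ≤ r := by simpa [dist_eq_norm] using hz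
  rcases hza.lt_or_eq with h | h
  · have hzb : z ∈ Metric.ball a r := by simpa [dist_eq_norm] using h
    exact ⟨z, hzb, (hmin.on_subset Metric.ball_subset_closedBall).isLocalMin
      (Metric.isOpen_ball.mem_nhds hzb)⟩
  · exfalso
    have h1 := hmin.localize.hasFDerivWithinAt_nonneg
      (hφ z hz).hasFDerivAt.hasFDerivWithinAt
      (sub_mem_posTangentConeAt_of_segment_subset ((convex_closedBall a r).segment_subset hz
        (Metric.mem_closedBall_self hr.le)))
    have h2 := hP z h
    rw [InnerProductSpace.toDual_apply_apply, ← neg_sub, inner_neg_right] at h1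
    linarith

/-- Let `P(x, δ²)` be the gradient of `Φ δ` at `x`, where `P` is strictly differentiable at `(a, 0)`
with `P(a, 0) = 0` and with a partial derivative in `x` that has positive quadratic form. For small
`δ` the nearest local minimizers of `Φ δ` exist and are within `O(δ²)` of `a`, and the gradient of
`Φ δ` is bounded by the distance to them. Strict differentiability makes `P(·, t)` strongly monotone
and Lipschitz on a ball around `a`, uniformly in `t`. -/
theorem exists_nearestLocalMins_bounds {Φ : ℝ → Vec n → ℝ} {P : Vec n × ℝ → Vec n}
    {P' : Vec n × ℝ →L[ℝ] Vec n} {a : Vec n} (hP : HasStrictFDerivAt P P' (a, 0))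
    (hP0 : P (a, 0) = 0) (hpos : ∀ p, p ≠ 0 → 0 < inner ℝ p (P' (p, 0)))
    (hΦ : ∀ᶠ p in 𝓝 ((a, 0) : Vec n × ℝ), ∀ δ, δ ^ 2 = p.2 →
      HasGradientAt (Φ δ) (P p) p.1) :
    ∃ r C L δ₁ : ℝ, 0 < r ∧ 0 ≤ C ∧ 0 ≤ L ∧ 0 < δ₁ ∧ ∀ δ, 0 < δ → δ ≤ δ₁ →
      (nearestLocalMins (Φ δ) a).Nonempty ∧ ∀ z ∈ nearestLocalMins (Φ δ) a,
        ‖z - a‖ ≤ C * δ ^ 2 ∧ ∀ x ∈ Metric.ball a r, ‖gradient (Φ δ) x‖ ≤ L * ‖x - z‖ := by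
  obtain ⟨μ, hμ, hco⟩ := exists_pos_mul_sq_le_inner
    (P' ∘L ContinuousLinearMap.inl ℝ (Vec n) ℝ) (by simpa using hpos)
  -- `P` is Lipschitz and approximately linear, with a small constant, on pairs near `(a, 0)`
  have hlin := hP.isLittleO.def (half_pos hμ)
  obtain ⟨L, hL, hlip⟩ := hP.isBigO_sub.exists_nonneg
  obtain ⟨ε₁, hε₁, hnear⟩ := Metric.eventually_nhds_iff.1 (hlin.and hlip.bound)
  obtain ⟨ε₂, hε₂, hgrad⟩ := Metric.eventually_nhds_iff.1 hΦ
  set ε := min ε₁ ε₂ with hε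
  have hε0 : 0 < ε := lt_min hε₁ hε₂
  have hmem : ∀ x ∈ Metric.closedBall a (ε / 2), ∀ t : ℝ, 0 ≤ t → t < ε →
      dist (x, t) (a, (0 : ℝ)) < ε := by
    intro x hx t ht htε
    rw [Prod.dist_eq, max_lt_iff]
    refine ⟨(Metric.mem_closedBall.1 hx).trans_lt (by linarith), ?_⟩
    simpa [abs_of_nonneg ht] using htε
  have hpair : ∀ p q : Vec n × ℝ, dist p (a, 0) < ε → dist q (a, 0) < ε →
      ‖P p - P q - P' (p - q)‖ ≤ μ / 2 * ‖p - q‖ ∧ ‖P p - P q‖ ≤ L * ‖p - q‖ := fun p q hp hq =>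
    hnear (y := (p, q)) (max_lt (hp.trans_le (min_le_left _ _)) (hq.trans_le (min_le_left _ _)))
  have hball : Metric.ball a (ε / 2) ⊆ Metric.closedBall a (ε / 2) :=
    Metric.ball_subset_closedBall
  have ha : a ∈ Metric.closedBall a (ε / 2) := Metric.mem_closedBall_self (by positivity)
  have hsub : ∀ (x y : Vec n) (t : ℝ), ((x, t) : Vec n × ℝ) - (y, t) = (x - y, 0) := by
    intro x y t; simp
  have hmono : ∀ x ∈ Metric.closedBall a (ε / 2), ∀ y ∈ Metric.closedBall a (ε / 2), ∀ t : ℝ,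
      0 ≤ t → t < ε →
      μ / 2 * ‖x - y‖ ^ 2 ≤ inner ℝ (P (x, t) - P (y, t)) (x - y) := by
    intro x hx y hy t ht htε
    have h := (hpair _ _ (hmem x hx t ht htε) (hmem y hy t ht htε)).1
    have hn : ‖((x - y, 0) : Vec n × ℝ)‖ = ‖x - y‖ := by simp [Prod.norm_def]
    rw [hsub, hn] at h
    have h1 := hco (x - y)
    rw [ContinuousLinearMap.comp_apply, ContinuousLinearMap.inl_apply, real_inner_comm] at h1
    have h2 := neg_le_of_abs_le (abs_real_inner_le_norm
      (P (x, t) - P (y, t) - P' (x - y, 0)) (x - y))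
    rw [inner_sub_left] at h2
    nlinarith [mul_le_mul_of_nonneg_right h (norm_nonneg (x - y))]
  have hLip : ∀ x ∈ Metric.closedBall a (ε / 2), ∀ y ∈ Metric.closedBall a (ε / 2), ∀ t : ℝ,
      0 ≤ t → t < ε → ‖P (x, t) - P (y, t)‖ ≤ L * ‖x - y‖ := by
    intro x hx y hy t ht htε
    have h := (hpair _ _ (hmem x hx t ht htε) (hmem y hy t ht htε)).2
    have hn : ‖((x - y, 0) : Vec n × ℝ)‖ = ‖x - y‖ := by simp [Prod.norm_def]
    rwa [hsub, hn] at h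
  have hPa : ∀ t : ℝ, 0 ≤ t → t < ε → ‖P (a, t)‖ ≤ L * t := by
    intro t ht htε
    have h := (hpair _ _ (hmem a ha t ht htε) (hmem a ha 0 le_rfl hε0)).2
    simpa [hP0, Prod.norm_def, abs_of_nonneg ht, max_eq_right ht] using h
  -- `δ² < ε`, and `L δ²` is so small that the gradient of `Φ δ` points outwards on the sphere
  refine ⟨ε / 2, 2 * L / μ, L, min 1 (min (ε / 2) (μ * ε / (8 * (L + 1)))), by positivity,
    by positivity, hL, by positivity, fun δ hδ hδ₁ => ?_⟩
  have hδ1 : δ ≤ 1 := hδ₁.trans (min_le_left _ _)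
  have hδ2 : δ ≤ ε / 2 := hδ₁.trans ((min_le_right _ _).trans (min_le_left _ _))
  have hδ3 : δ ≤ μ * ε / (8 * (L + 1)) :=
    hδ₁.trans ((min_le_right _ _).trans (min_le_right _ _))
  rw [le_div_iff₀ (by positivity)] at hδ3
  have hsq : δ ^ 2 ≤ δ := by nlinarith
  have ht0 : 0 ≤ δ ^ 2 := sq_nonneg δ
  have htε : δ ^ 2 < ε := by linarith
  have hG : ∀ x ∈ Metric.closedBall a (ε / 2), HasGradientAt (Φ δ) (P (x, δ ^ 2)) x :=
    fun x hx => hgrad ((hmem x hx _ ht0 htε).trans_le (min_le_right _ _)) δ rfl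
  have hcrit : ∀ w ∈ Metric.ball a (ε / 2), IsLocalMin (Φ δ) w → P (w, δ ^ 2) = 0 := by
    intro w hw hmin
    simpa using hmin.hasFDerivAt_eq_zero (hG w (hball hw)).hasFDerivAt
  obtain ⟨z, hz, hzmin⟩ := exists_isLocalMin_of_inner_pos (half_pos hε0) hG (by
    intro x hx
    have hx' : x ∈ Metric.closedBall a (ε / 2) := by simp [dist_eq_norm, hx]
    have h1 := hmono x hx' a ha _ ht0 htε
    have h2 := neg_le_of_abs_le (abs_real_inner_le_norm (P (a, δ ^ 2)) (x - a))
    have h3 := hPa _ ht0 htε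
    rw [inner_sub_left, hx] at h1
    rw [hx] at h2
    have h4 : L * δ ^ 2 ≤ μ * ε / 8 := by nlinarith
    have h5 : ‖P (a, δ ^ 2)‖ * (ε / 2) ≤ μ * ε / 8 * (ε / 2) := by gcongr; linarith
    have h6 : 0 < μ * ε * ε := by positivity
    nlinarith)
  have huniq : ∀ w ∈ Metric.ball a (ε / 2), IsLocalMin (Φ δ) w → w = z := by
    intro w hw hmin
    have h := hmono w (hball hw) z (hball hz) _ ht0 htε
    rw [hcrit w hw hmin, hcrit z hz hzmin, sub_zero, inner_zero_left] at h
    have : ‖w - z‖ ^ 2 = 0 := by nlinarith [sq_nonneg ‖w - z‖]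
    exact sub_eq_zero.1 (by simpa using this)
  rw [Metric.mem_ball, dist_eq_norm] at hz
  refine ⟨⟨z, hzmin, fun w hw => ?_⟩, fun w ⟨hw, hwz⟩ => ?_⟩
  · by_contra! hlt
    rw [huniq w (by rw [Metric.mem_ball, dist_eq_norm]; linarith) hw] at hlt
    exact lt_irrefl _ hlt
  · have hwb : w ∈ Metric.ball a (ε / 2) := by
      rw [Metric.mem_ball, dist_eq_norm]
      exact (hwz z hzmin).trans_lt hz
    have hw0 := hcrit w hwb hw
    refine ⟨?_, fun x hx => ?_⟩
    · have h1 := hmono w (hball hwb) a ha _ ht0 htε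
      have h2 := hPa _ ht0 htε
      have h3 := real_inner_le_norm (-P (a, δ ^ 2)) (w - a)
      rw [hw0, zero_sub] at h1
      rw [norm_neg] at h3
      rcases (norm_nonneg (w - a)).eq_or_lt with h0 | h0
      · rw [← h0]; positivity
      · have h4 : μ / 2 * ‖w - a‖ ≤ L * δ ^ 2 := by
          refine le_of_mul_le_mul_right ?_ h0
          nlinarith [mul_le_mul_of_nonneg_right h2 h0.le]
        rw [div_mul_eq_mul_div, le_div_iff₀ hμ]
        linarith
    · have := hLip x (hball hx) w (hball hwb) _ ht0 htε
      rw [hw0, sub_zero] at this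
      rwa [(hG x (hball hx)).gradient]

/-! ### The adaptive iteration -/

theorem tendsto_zero_of_le_half {β : ℕ → ℝ} (h0 : ∀ k, 0 ≤ β k)
    (h : ∀ k, β (k + 1) ≤ β k / 2) : Tendsto β atTop (𝓝 0) := by
  have hb : ∀ k, β k ≤ β 0 * (1 / 2) ^ k := by
    intro k
    induction k with
    | zero => simp
    | succ k ih => rw [pow_succ]; linarith [h k]
  refine squeeze_zero h0 hb ?_
  simpa using (tendsto_pow_atTop_nhds_zero_of_lt_one (r := (1 / 2 : ℝ)) (by norm_num)
    (by norm_num)).const_mul (β 0)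

/-- One pass of the adaptive iteration. The quantity `‖x - z(δ)‖ + δ²` contracts quadratically: the
step to the minimizer `z(δn)` is quadratic, the minimizers are within `O(δ²)` of `a`, and `δn` is at
most the maximum of `δ²` and of the gradient norm, which is `O(‖x - z(δ)‖)`, so that `δn²` is
quadratically small. -/
theorem adaptive_step_bound {Φ : ℝ → Vec n → ℝ} {G : (Vec n → ℝ) → Vec n → Vec n}
    {z : ℝ → Vec n} {a x : Vec n} {C L M δ₁ δ δn : ℝ} (hL : 0 ≤ L) (hM : 0 ≤ M)
    (hC : 0 ≤ C) (hz : ∀ δ, 0 < δ → δ ≤ δ₁ → ‖z δ - a‖ ≤ C * δ ^ 2)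
    (hgrad : ‖gradient (Φ δ) x‖ ≤ L * ‖x - z δ‖)
    (hG : ∀ δ, 0 < δ → δ ≤ δ₁ → ‖x + G (Φ δ) x - z δ‖ ≤ M * ‖x - z δ‖ ^ 2)
    (h0 : 0 < δ) (h1 : δ ≤ 1) (hδ : δ ≤ δ₁)
    (hδn : δn = max (min ‖gradient (Φ δ) x‖ δ) (δ ^ 2)) :
    0 < δn ∧ δn ≤ δ ∧ ‖x + G (Φ δn) x - z δn‖ + δn ^ 2 ≤
      (M * (1 + 2 * C) ^ 2 + (L + 1) ^ 2) * (‖x - z δ‖ + δ ^ 2) ^ 2 := by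
  have hn0 : 0 < δn := hδn ▸ lt_max_of_lt_right (by positivity)
  have hnδ : δn ≤ δ := hδn ▸ max_le (min_le_right _ _) (by nlinarith)
  refine ⟨hn0, hnδ, ?_⟩
  have hd : 0 ≤ ‖x - z δ‖ := norm_nonneg _
  have hnβ : δn ≤ (L + 1) * (‖x - z δ‖ + δ ^ 2) := by
    have e1 : 0 ≤ L * δ ^ 2 := by positivity
    have e2 : 0 ≤ L * ‖x - z δ‖ := by positivity
    have e3 : 0 ≤ δ ^ 2 := sq_nonneg δ
    rw [hδn, add_mul, mul_add]
    exact max_le ((min_le_left _ _).trans (by linarith)) (by linarith)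
  have hr : ‖x - z δn‖ ≤ (1 + 2 * C) * (‖x - z δ‖ + δ ^ 2) := by
    have e1 := hz δ h0 hδ
    have e2 := hz δn hn0 (hnδ.trans hδ)
    have e3 := norm_sub_le_norm_sub_add_norm_sub x (z δ) (z δn)
    have e4 := norm_sub_le_norm_sub_add_norm_sub (z δ) a (z δn)
    rw [norm_sub_rev a] at e4
    have e5 : C * δn ^ 2 ≤ C * δ ^ 2 := by gcongr
    have e6 : 0 ≤ C * ‖x - z δ‖ := by positivity
    have e7 : (1 + 2 * C) * (‖x - z δ‖ + δ ^ 2) =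
      ‖x - z δ‖ + δ ^ 2 + 2 * (C * ‖x - z δ‖) + 2 * (C * δ ^ 2) := by ring
    linarith [sq_nonneg δ]
  calc ‖x + G (Φ δn) x - z δn‖ + δn ^ 2
      ≤ M * ((1 + 2 * C) * (‖x - z δ‖ + δ ^ 2)) ^ 2 +
          ((L + 1) * (‖x - z δ‖ + δ ^ 2)) ^ 2 := by
        refine add_le_add ((hG δn hn0 (hnδ.trans hδ)).trans ?_) ?_ <;> gcongr
    _ = _ := by ring

/-- Local convergence of the adaptive iteration: the error is bounded by a multiple of
`β = ‖x - z(δ)‖ + δ²`, which tends to zero quadratically. -/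
theorem algState_convergesWithROrder {Φ : ℝ → Vec n → ℝ} {G : (Vec n → ℝ) → Vec n → Vec n}
    {z : ℝ → Vec n} {a : Vec n} {U : Set (Vec n)} (hU : IsOpen U) (haU : a ∈ U)
    {C L M δ₁ : ℝ} (hC : 0 ≤ C) (hL : 0 ≤ L) (hM : 0 ≤ M) (hδ₁ : 0 < δ₁)
    (hz : ∀ δ, 0 < δ → δ ≤ δ₁ → ‖z δ - a‖ ≤ C * δ ^ 2)
    (hgrad : ∀ δ, 0 < δ → δ ≤ δ₁ → ∀ x ∈ U, ‖gradient (Φ δ) x‖ ≤ L * ‖x - z δ‖)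
    (hG : ∀ δ, 0 < δ → δ ≤ δ₁ → ∀ x ∈ U, ‖x + G (Φ δ) x - z δ‖ ≤ M * ‖x - z δ‖ ^ 2) :
    ∃ B' : Set (Vec n), IsOpen B' ∧ a ∈ B' ∧ ∃ δ' : ℝ, 0 < δ' ∧ δ' < 1 ∧
      ∀ x₁ ∈ B', ∀ δ₀ : ℝ, 0 < δ₀ → δ₀ ≤ δ' →
        Tendsto (fun k => (algState G Φ (fun δ => δ ^ 2) x₁ δ₀ k).1) atTop (𝓝 a) ∧
          ConvergesWithROrder (fun k => (algState G Φ (fun δ => δ ^ 2) x₁ δ₀ k).1) a 2 := by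
  obtain ⟨ε, hε, hεU⟩ := Metric.isOpen_iff.1 hU a haU
  obtain ⟨K, hK⟩ : ∃ K, K = M * (1 + 2 * C) ^ 2 + (L + 1) ^ 2 := ⟨_, rfl⟩
  have hK0 : 0 < K := by rw [hK]; positivity
  -- `(1 + C) ρ < ε` keeps the iterates in `U`, and `K ρ ≤ 1 / 2` makes `β` decrease
  obtain ⟨ρ, hρ0, hρε, hρK⟩ : ∃ ρ > 0, (1 + C) * ρ < ε ∧ K * ρ ≤ 1 / 2 := by
    refine ⟨min (ε / (2 * (1 + C))) (1 / (2 * K)), by positivity, ?_, ?_⟩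
    · calc (1 + C) * _ ≤ (1 + C) * (ε / (2 * (1 + C))) := by gcongr; exact min_le_left _ _
        _ = ε / 2 := by field_simp
        _ < ε := by linarith
    · calc K * _ ≤ K * (1 / (2 * K)) := by gcongr; exact min_le_right _ _
        _ = 1 / 2 := by field_simp
  obtain ⟨δ', hδ'0, hδ'1, hδ'2, hδ'3⟩ :
      ∃ δ' > 0, δ' ≤ δ₁ ∧ δ' ≤ 1 / 2 ∧ (1 + C) * δ' ≤ ρ / 2 := by
    refine ⟨min (min δ₁ (1 / 2)) (ρ / (2 * (1 + C))), by positivity,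
      (min_le_left _ _).trans (min_le_left _ _), (min_le_left _ _).trans (min_le_right _ _), ?_⟩
    calc (1 + C) * _ ≤ (1 + C) * (ρ / (2 * (1 + C))) := by gcongr; exact min_le_right _ _
      _ = ρ / 2 := by field_simp
  refine ⟨Metric.ball a (ρ / 2), Metric.isOpen_ball, Metric.mem_ball_self (by positivity), δ',
    hδ'0, by linarith, fun x₁ hx₁ δ₀ hδ₀ hδ₀' => ?_⟩
  set s := algState G Φ (fun δ => δ ^ 2) x₁ δ₀
  obtain ⟨β, hβ⟩ : ∃ β : ℕ → ℝ, ∀ k, β k = ‖(s k).1 - z (s k).2‖ + (s k).2 ^ 2 :=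
    ⟨_, fun _ => rfl⟩
  have hβ0 : ∀ k, 0 ≤ β k := fun k => by rw [hβ]; positivity
  have hclose : ∀ k, 0 < (s k).2 → (s k).2 ≤ δ' → ‖(s k).1 - a‖ ≤ (1 + C) * β k := by
    intro k h1 h2
    have h3 := hz _ h1 (h2.trans hδ'1)
    have h4 := norm_sub_le_norm_sub_add_norm_sub (s k).1 (z (s k).2) a
    have h5 : 0 ≤ C * ‖(s k).1 - z (s k).2‖ := by positivity
    rw [hβ, add_mul, mul_add]
    linarith [sq_nonneg (s k).2]
  have hstep : ∀ k, 0 < (s k).2 → (s k).2 ≤ δ' → β k ≤ ρ →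
      0 < (s (k + 1)).2 ∧ (s (k + 1)).2 ≤ (s k).2 ∧ β (k + 1) ≤ K * β k ^ 2 := by
    intro k h1 h2 h3
    have hxU : (s k).1 ∈ U := by
      refine hεU ?_
      rw [Metric.mem_ball, dist_eq_norm]
      exact (hclose k h1 h2).trans_lt (lt_of_le_of_lt (by gcongr) hρε)
    rw [hβ, hβ, hK]
    exact adaptive_step_bound hL hM hC hz (hgrad _ h1 (h2.trans hδ'1) _ hxU)
      (fun δ h h' => hG δ h h' _ hxU) h1 (by linarith) (h2.trans hδ'1) rfl
  have hinv : ∀ k, 0 < (s k).2 ∧ (s k).2 ≤ δ' ∧ β k ≤ ρ := by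
    intro k
    induction k with
    | zero =>
      refine ⟨hδ₀, hδ₀', ?_⟩
      have h1 := hz δ₀ hδ₀ (hδ₀'.trans hδ'1)
      have h2 := norm_sub_le_norm_sub_add_norm_sub x₁ a (z δ₀)
      rw [norm_sub_rev a] at h2
      rw [Metric.mem_ball, dist_eq_norm] at hx₁
      have h3 : δ₀ ^ 2 ≤ δ' := by nlinarith
      have h4 : (1 + C) * δ₀ ^ 2 ≤ (1 + C) * δ' := by gcongr
      rw [hβ]
      change ‖x₁ - z δ₀‖ + δ₀ ^ 2 ≤ ρ
      linarith
    | succ k ih =>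
      obtain ⟨h1, h2, h3⟩ := ih
      obtain ⟨h4, h5, h6⟩ := hstep k h1 h2 h3
      refine ⟨h4, h5.trans h2, h6.trans ?_⟩
      calc K * β k ^ 2 = (K * β k) * β k := by ring
        _ ≤ (K * ρ) * β k := by gcongr; exact hβ0 k
        _ ≤ 1 / 2 * β k := by gcongr; exact hβ0 k
        _ ≤ ρ := by linarith
  have hquad : ∀ k, β (k + 1) ≤ K * β k ^ 2 := fun k =>
    (hstep k (hinv k).1 (hinv k).2.1 (hinv k).2.2).2.2
  have hβlim : Tendsto β atTop (𝓝 0) := by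
    refine tendsto_zero_of_le_half hβ0 fun k => (hquad k).trans ?_
    have h1 : K * β k ≤ 1 / 2 := (mul_le_mul_of_nonneg_left (hinv k).2.2 hK0.le).trans hρK
    nlinarith [hβ0 k]
  have hbound : ∀ k, ‖(s k).1 - a‖ ≤ (1 + C) * β k := fun k =>
    hclose k (hinv k).1 (hinv k).2.1
  have hαlim : Tendsto (fun k => (1 + C) * β k) atTop (𝓝 0) := by
    simpa using hβlim.const_mul (1 + C)
  refine ⟨tendsto_iff_norm_sub_tendsto_zero.2
    (squeeze_zero (fun _ => norm_nonneg _) hbound hαlim), fun k => (1 + C) * β k,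
    Eventually.of_forall hbound, hαlim, K, hK0, Eventually.of_forall fun k => ?_⟩
  have h1C : 0 ≤ 1 + C := by positivity
  rw [sub_zero, sub_zero, Real.norm_of_nonneg (mul_nonneg h1C (hβ0 _)),
    Real.norm_of_nonneg (mul_nonneg h1C (hβ0 _)), Real.rpow_two]
  calc (1 + C) * β (k + 1) ≤ (1 + C) * (K * β k ^ 2) := by gcongr; exact hquad k
    _ ≤ (1 + C) * ((1 + C) * (K * β k ^ 2)) := by
      have : 0 ≤ (1 + C) * (K * β k ^ 2) := by positivity
      nlinarith
    _ = K * ((1 + C) * β k) ^ 2 := by ring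

end

end FletcherPenalty

/-! ### Convergence of the method for the penalty function -/

theorem mainTheorem2 {n m : ℕ}
    (f : FletcherPenalty.Vec n → ℝ) (c : FletcherPenalty.Vec n → FletcherPenalty.Vec m)
    (hf : ContDiff ℝ 3 f) (hc : ContDiff ℝ 3 c)
    (hLICQ : ∀ x, FletcherPenalty.IsFirstOrderKKT f c x → FletcherPenalty.LICQAt c x)
    (σ : ℝ) (hσ : 0 ≤ σ)
    (xstar : FletcherPenalty.Vec n) (hKKT : FletcherPenalty.IsSecondOrderKKT f c xstar)
    (hpos : ∀ p : FletcherPenalty.Vec n, p ≠ 0 →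
      0 < inner ℝ p (FletcherPenalty.hess (FletcherPenalty.penalty f c σ 0) xstar p))
    (δbar : ℝ) (hδbar : 0 < δbar)
    (xmin : ℝ → FletcherPenalty.Vec n)
    -- `xmin δ` is the point `x(δ)`: a local minimizer of `φ_σ(·;δ)` nearest to `x*`, if there is one
    (hxmin : ∀ δ : ℝ, 0 < δ → δ ≤ δbar →
      (FletcherPenalty.nearestLocalMins (FletcherPenalty.penalty f c σ δ) xstar).Nonempty →
      xmin δ ∈ FletcherPenalty.nearestLocalMins (FletcherPenalty.penalty f c σ δ) xstar)
    (G : (FletcherPenalty.Vec n → ℝ) → FletcherPenalty.Vec n → FletcherPenalty.Vec n)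
    (B : Set (FletcherPenalty.Vec n)) (hB : IsOpen B) (hxB : xstar ∈ B)
    (Mδ : ℝ → ℝ) (M : ℝ) (hM : ∀ δ : ℝ, 0 < δ → δ ≤ δbar → Mδ δ ≤ M)
    (hG : ∀ δ : ℝ, 0 < δ → δ ≤ δbar → ∀ z₀ ∈ B,
      Filter.Tendsto (FletcherPenalty.innerIter G (FletcherPenalty.penalty f c σ δ) z₀)
        Filter.atTop (nhds (xmin δ)) ∧
      ∀ k : ℕ,
        ‖xmin δ - FletcherPenalty.innerIter G (FletcherPenalty.penalty f c σ δ) z₀ (k + 1)‖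
          ≤ Mδ δ *
            ‖xmin δ - FletcherPenalty.innerIter G (FletcherPenalty.penalty f c σ δ) z₀ k‖ ^ 2) :
    ∃ B' : Set (FletcherPenalty.Vec n), IsOpen B' ∧ xstar ∈ B' ∧
      ∃ δ' : ℝ, 0 < δ' ∧ δ' < 1 ∧
        ∀ x₁ ∈ B', ∀ δ₀ : ℝ, 0 < δ₀ → δ₀ ≤ δ' →
          let x : ℕ → FletcherPenalty.Vec n := fun k =>
            (FletcherPenalty.algState G (FletcherPenalty.penalty f c σ) (fun δ => δ ^ 2)
              x₁ δ₀ k).1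
          Filter.Tendsto x Filter.atTop (nhds xstar) ∧
            FletcherPenalty.ConvergesWithROrder x xstar 2 := by
  obtain ⟨hfirst, -⟩ := hKKT
  have hcd := hc.differentiable (by norm_num) xstar
  have hu := (hLICQ xstar hfirst).isUnit_normalOp hcd
  set P := FletcherPenalty.partialGrad f c σ
  have hu0 : IsUnit (FletcherPenalty.normalOp c (xstar, (0 : ℝ) ^ 2)) := by simpa using hu
  have hopen := FletcherPenalty.isOpen_isUnit_normalOp hc
  have hstrict : HasStrictFDerivAt P (fderiv ℝ P (xstar, 0)) (xstar, 0) :=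
    (FletcherPenalty.contDiffAt_partialGrad hf hc σ hu).hasStrictFDerivAt (by norm_num)
  have hhess : FletcherPenalty.hess (FletcherPenalty.penalty f c σ 0) xstar =
      fderiv ℝ P (xstar, 0) ∘L ContinuousLinearMap.inl ℝ (FletcherPenalty.Vec n) ℝ := by
    have hev : gradient (FletcherPenalty.penalty f c σ 0) =ᶠ[𝓝 xstar] fun z => P (z, 0) := by
      have : ∀ᶠ z in 𝓝 xstar, IsUnit (FletcherPenalty.normalOp c (z, (0 : ℝ) ^ 2)) :=
        (Continuous.prodMk_left ((0 : ℝ) ^ 2)).continuousAt.eventually (hopen.mem_nhds hu0)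
      filter_upwards [this] with z hz
      simpa using (FletcherPenalty.hasGradientAt_penalty hf hc σ hz).gradient
    rw [FletcherPenalty.hess, hev.fderiv_eq]
    exact (HasFDerivAt.comp (f := fun z => (z, (0 : ℝ))) xstar hstrict.hasFDerivAt
      (hasFDerivAt_prodMk_left xstar (0 : ℝ))).fderiv
  obtain ⟨r, C, L, δ₁, hr, hC, hL, hδ₁, hloc⟩ :=
    FletcherPenalty.exists_nearestLocalMins_bounds (Φ := FletcherPenalty.penalty f c σ) hstrict
      (FletcherPenalty.partialGrad_eq_zero hf hc σ hfirst hu)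
      (fun p hp => by simpa [hhess] using hpos p hp)
      (by
        filter_upwards [hopen.mem_nhds hu] with p hp δ hδ
        obtain ⟨x, t⟩ := p
        obtain rfl : δ ^ 2 = t := hδ
        exact FletcherPenalty.hasGradientAt_penalty hf hc σ hp)
  have hloc' : ∀ δ, 0 < δ → δ ≤ min δ₁ δbar → ‖xmin δ - xstar‖ ≤ C * δ ^ 2 ∧
      ∀ x ∈ Metric.ball xstar r,
        ‖gradient (FletcherPenalty.penalty f c σ δ) x‖ ≤ L * ‖x - xmin δ‖ := by
    intro δ h0 h1
    obtain ⟨hne, h⟩ := hloc δ h0 (h1.trans (min_le_left _ _))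
    exact h _ (hxmin δ h0 (h1.trans (min_le_right _ _)) hne)
  refine FletcherPenalty.algState_convergesWithROrder (z := xmin) (hB.inter Metric.isOpen_ball)
    ⟨hxB, Metric.mem_ball_self hr⟩ hC hL (le_max_right M 0) (lt_min hδ₁ hδbar)
    (fun δ h0 h1 => (hloc' δ h0 h1).1) (fun δ h0 h1 x hx => (hloc' δ h0 h1).2 x hx.2)
    fun δ h0 h1 x hx => ?_
  have h1' : δ ≤ δbar := h1.trans (min_le_right _ _)
  -- the first step of the inner method started at `x`
  have h := (hG δ h0 h1' x hx.1).2 0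
  simp only [FletcherPenalty.innerIter] at h
  rw [norm_sub_rev, norm_sub_rev x]
  exact h.trans (by gcongr; exact (hM δ h0 h1').trans (le_max_left _ _))
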